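/- Let $n\ge 5$ be an odd integer and let $\mathbb{S}^n$ be the unit sphere of $\mathbb{R}^{n+1}$. Then there exist a real number $a>0$ and a full Riemannian immersion $$\phi:\ T^2=\mathbb{R}^2/\Lambda_a\longrightarrow\mathbb{S}^n,\qquad \Lambda_a=\{(2\pi ka,2\pi la):k,l\in\mathbb{Z}\},$$ of the flat square torus $T^2$ which has constant mean curvature and is proper-biharmonic. Here $\phi$ is a Riemannian immersion if it is smooth and $d\phi$ preserves inner products; it is full if its image lies in no totally geodesic sphere $\mathbb{S}^{n'}\subset\mathbb{S}^n$ with $n'<n$ (equivalently, in no proper linear subspace of $\mathbb{R}^{n+1}$); it has constant mean curvature if $|H|$ is constant, where $H=\tfrac12\operatorname{trace}B$ and $B$ is the second fundamental form of $\phi$ in $\mathbb{S}^n$. With the tension field $\tau(\phi)=\operatorname{trace}\nabla d\phi$, the map $\phi$ is harmonic if $\tau(\phi)=0$; it is biharmonic if it is a critical point of the bienergy $E_2(\phi)=\tfrac12\int_{T^2}|\tau(\phi)|^2\,v_g$, i.e. $\frac{d}{dt}\big|_{t=0}E_2(\phi_t)=0$ for every smooth variation $(\phi_t)_{t\in\mathbb{R}}$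 of $\phi=\phi_0$ by maps $T^2\to\mathbb{S}^n$; and it is proper-biharmonic if it is biharmonic but not harmonic. -/

import Mathlib

open scoped ContDiff

noncomputable section

namespace SquareTorusImmersion

/-- The Euclidean plane. -/
abbrev Plane : Type := EuclideanSpace ℝ (Fin 2)

/-- The Euclidean space `ℝ^{n+1}`. -/
abbrev Ambient (n : ℕ) : Type := EuclideanSpace ℝ (Fin (n + 1))

/-- The unit sphere `S^n` in `ℝ^{n+1}`. -/
abbrev UnitSphere (n : ℕ) : Type := Metric.sphere (0 : Ambient n) 1

/-- The square lattice `{(2πka, 2πla) : k, l ∈ ℤ}` in the plane. -/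
def squareLattice (a : ℝ) : AddSubgroup Plane where
  carrier := {z | ∃ k : Fin 2 → ℤ, ∀ i, z i = 2 * Real.pi * a * (k i : ℝ)}
  zero_mem' := ⟨0, fun i => by simp⟩
  add_mem' := by
    rintro x y ⟨k, hk⟩ ⟨l, hl⟩
    exact ⟨k + l, fun i => by simp [hk i, hl i, mul_add]⟩
  neg_mem' := by
    rintro x ⟨k, hk⟩
    exact ⟨-k, fun i => by simp [hk i]⟩

/-- The square torus `ℝ² / {(2πka, 2πla) : k, l ∈ ℤ}`. Its smooth structure and flat metric are the
ones for which the projection from the plane is a local isometry (when `a ≠ 0`), so local notions on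
the torus are expressed below through lifts to the plane. -/
abbrev SquareTorus (a : ℝ) : Type := Plane ⧸ squareLattice a

variable {a : ℝ} {n : ℕ}

/-- The lift to the plane of a map from the torus to the sphere, seen as a map into `ℝ^{n+1}`. -/
def lift (φ : SquareTorus a → UnitSphere n) : Plane → Ambient n :=
  fun z => (φ (QuotientAddGroup.mk z) : Ambient n)

/-- Smoothness of a map from the torus to the sphere. -/
def IsSmoothMap (φ : SquareTorus a → UnitSphere n) : Prop :=
  ContDiff ℝ ∞ (lift φ)

/-- `φ` is a Riemannian (isometric) immersion: it is smooth and its differential preserves the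
inner products of tangent vectors. -/
def IsRiemannianImmersion (φ : SquareTorus a → UnitSphere n) : Prop :=
  IsSmoothMap φ ∧
    ∀ z u v : Plane, inner ℝ (fderiv ℝ (lift φ) z u) (fderiv ℝ (lift φ) z v) = inner ℝ u v

/-- `φ` is full: its image lies in no totally geodesic sphere `S^{n'} ⊂ S^n` with `n' < n`, that is,
in no proper linear subspace of `ℝ^{n+1}`. -/
def IsFull (φ : SquareTorus a → UnitSphere n) : Prop :=
  ∀ W : Submodule ℝ (Ambient n), (∀ x, (φ x : Ambient n) ∈ W) → W = ⊤

/-- The connection of the pull-back bundle `φ⁻¹ T S^n`: the derivative in the direction `u` of the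
section `V` along `φ`, projected to the tangent space of the sphere at the point `φ(z)`. -/
def covDeriv (φ : SquareTorus a → UnitSphere n) (V : Plane → Ambient n) (z u : Plane) : Ambient n :=
  fderiv ℝ V z u - inner ℝ (fderiv ℝ V z u) (lift φ z) • lift φ z

/-- The Hessian `(∇dφ)(u, v) = ∇_u (dφ(v)) - dφ(∇_u v)` at `z`; the second term vanishes as the
metric of the torus is flat and `v` is extended to a constant vector field. -/
def hessian (φ : SquareTorus a → UnitSphere n) (z u v : Plane) : Ambient n :=
  covDeriv φ (fun w => fderiv ℝ (lift φ) w v) z u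

/-- The standard orthonormal basis of the plane. -/
def stdVec (i : Fin 2) : Plane := EuclideanSpace.single i (1 : ℝ)

/-- The tension field `τ(φ) = trace ∇dφ`. -/
def tension (φ : SquareTorus a → UnitSphere n) (z : Plane) : Ambient n :=
  ∑ i, hessian φ z (stdVec i) (stdVec i)

/-- `φ` is harmonic: its tension field vanishes. -/
def IsHarmonicMap (φ : SquareTorus a → UnitSphere n) : Prop :=
  ∀ z, tension φ z = 0

/-- The fundamental domain `[0, 2πa)²` of the square lattice. -/
def fundamentalSquare (a : ℝ) : Set Plane :=
  {z | ∀ i, z i ∈ Set.Ico 0 (2 * Real.pi * a)}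

/-- The bienergy `E₂(φ) = (1/2) ∫_{T²} |τ(φ)|² v_g`. -/
def bienergy (φ : SquareTorus a → UnitSphere n) : ℝ :=
  (1 / 2) * ∫ z in fundamentalSquare a, ‖tension φ z‖ ^ 2

/-- A smooth variation of `φ`: a smooth one-parameter family of maps from the torus to the sphere
that equals `φ` at time `0`. -/
def IsSmoothVariation (φ : SquareTorus a → UnitSphere n)
    (Φ : ℝ → SquareTorus a → UnitSphere n) : Prop :=
  ContDiff ℝ ∞ (fun p : ℝ × Plane => lift (Φ p.1) p.2) ∧ Φ 0 = φ

/-- `φ` is biharmonic: it is a smooth critical point of the bienergy functional. -/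
def IsBiharmonicMap (φ : SquareTorus a → UnitSphere n) : Prop :=
  IsSmoothMap φ ∧ ∀ Φ : ℝ → SquareTorus a → UnitSphere n, IsSmoothVariation φ Φ →
    HasDerivAt (fun t => bienergy (Φ t)) 0 0

/-- `φ` is proper-biharmonic: biharmonic and not harmonic. -/
def IsProperBiharmonic (φ : SquareTorus a → UnitSphere n) : Prop :=
  IsBiharmonicMap φ ∧ ¬ IsHarmonicMap φ

/-- The tangent plane `dφ(T_z T²)`, as a subspace of `ℝ^{n+1}`. -/
def tangentPlane (φ : SquareTorus a → UnitSphere n) (z : Plane) : Submodule ℝ (Ambient n) :=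
  LinearMap.range (fderiv ℝ (lift φ) z).toLinearMap

/-- The second fundamental form of `φ` in the sphere: the component of `∇_u (dφ(v))`
normal to the surface. -/
def secondFundamentalForm (φ : SquareTorus a → UnitSphere n) (z u v : Plane) : Ambient n :=
  (tangentPlane φ z)ᗮ.starProjection (hessian φ z u v)

/-- The mean curvature vector `H = (1/2) trace B` of a Riemannian immersion of the torus, where `B`
is the second fundamental form. -/
def meanCurvatureVector (φ : SquareTorus a → UnitSphere n) (z : Plane) : Ambient n :=
  (1 / 2 : ℝ) • ∑ i, secondFundamentalForm φ z (stdVec i) (stdVec i)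

/-- `φ` has constant mean curvature: `|H|` is constant. -/
def IsCMC (φ : SquareTorus a → UnitSphere n) : Prop :=
  ∃ h : ℝ, ∀ z, ‖meanCurvatureVector φ z‖ = h

end SquareTorusImmersion

end

/-!
The immersion is a superposition `F` of plane waves `√(w k) exp(i⟪f k, z⟫)`, one in each complex
coordinate. It is isometric when the frequencies have weighted second moment matrix the identity,
and full because distinct characters are linearly independent. If moreover `|f k|² = 2 ± √c` for
every `k`, then `(Δ + 2)² F = c F`, while `τ = (Δ + 2) F` has constant length `√c`. By Green's
identity the first variation of the bienergy is the `L²` product of the variation field with the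
tangential part of `(Δ + 2) τ = c F`, which vanishes. Frequencies in a common square lattice come
from rational points of the unit circle, to which two points off the circle are added.
-/

noncomputable section

namespace SquareTorusImmersion

open MeasureTheory Set
open scoped Laplacian RealInnerProductSpace

section SecondDerivatives

variable {X E : Type*} [NormedAddCommGroup X] [NormedAddCommGroup E] [NormedSpace ℝ E]

section NormedSpace

variable [NormedSpace ℝ X] {G : X → E}

theorem contDiff_fderiv_apply (hG : ContDiff ℝ ∞ G) (u : X) :
    ContDiff ℝ ∞ fun x => fderiv ℝ G x u :=
  (hG.fderiv_right (m := ∞) (by simp)).clm_apply contDiff_const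

theorem fderiv_fderiv_apply (hG : ContDiff ℝ 2 G) (u v x : X) :
    fderiv ℝ (fun y => fderiv ℝ G y u) x v = fderiv ℝ (fderiv ℝ G) x v u := by
  have hd : DifferentiableAt ℝ (fderiv ℝ G) x :=
    (hG.fderiv_right (m := 1) (by norm_num)).differentiable one_ne_zero x
  simp [fderiv_clm_apply hd (differentiableAt_const u)]

theorem fderiv_fderiv_apply_comm (hG : ContDiff ℝ 2 G) (u v x : X) :
    fderiv ℝ (fun y => fderiv ℝ G y u) x v = fderiv ℝ (fun y => fderiv ℝ G y v) x u := by
  rw [fderiv_fderiv_apply hG, fderiv_fderiv_apply hG]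
  exact (hG.contDiffAt.isSymmSndFDerivAt (by simp)).eq v u

theorem periodic_fderiv {c : X} (hG : Function.Periodic G c) :
    Function.Periodic (fderiv ℝ G) c := fun x => by
  rw [← fderiv_comp_add_right]
  simp only [hG _]

end NormedSpace

variable [InnerProductSpace ℝ X] [FiniteDimensional ℝ X] {G : X → E}

theorem laplacian_eq_sum_fderiv_fderiv {ι : Type*} [Fintype ι] (b : OrthonormalBasis ι ℝ X)
    (hG : ContDiff ℝ 2 G) (x : X) :
    Δ G x = ∑ i, fderiv ℝ (fun y => fderiv ℝ G y (b i)) x (b i) := by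
  simp [InnerProductSpace.laplacian_eq_iteratedFDeriv_orthonormalBasis G b,
    iteratedFDeriv_two_apply, fderiv_fderiv_apply hG]

theorem contDiff_laplacian (hG : ContDiff ℝ ∞ G) : ContDiff ℝ ∞ (Δ G) := by
  rw [funext (laplacian_eq_sum_fderiv_fderiv (stdOrthonormalBasis ℝ X) (contDiff_infty.1 hG 2))]
  exact ContDiff.sum fun _ _ => contDiff_fderiv_apply (contDiff_fderiv_apply hG _) _

theorem periodic_laplacian {c : X} (hG : Function.Periodic G c) :
    Function.Periodic (Δ G) c := fun x => by
  have hG' : (fun y => G (y + c)) = G := funext hG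
  simp only [InnerProductSpace.laplacian_eq_iteratedFDeriv_stdOrthonormalBasis,
    ← iteratedFDeriv_comp_add_right, hG']

end SecondDerivatives

section Slices

variable {P X E : Type*} [NormedAddCommGroup P] [NormedSpace ℝ P] [NormedAddCommGroup X]
  [NormedAddCommGroup E] [NormedSpace ℝ E]

theorem fderiv_slice [NormedSpace ℝ X] {Ψ : P × X → E} {t : P} {x : X}
    (hΨ : DifferentiableAt ℝ Ψ (t, x)) (u : X) :
    fderiv ℝ (fun y => Ψ (t, y)) x u = fderiv ℝ Ψ (t, x) (0, u) := by
  have h : HasFDerivAt (fun y => Ψ (t, y)) (fderiv ℝ Ψ (t, x) ∘L .inr ℝ P X) x :=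
    hΨ.hasFDerivAt.comp x (hasFDerivAt_prodMk_right t x)
  simp [h.fderiv]

theorem hasDerivAt_slice [NormedSpace ℝ X] {Ψ : ℝ × X → E} {t : ℝ} {x : X}
    (hΨ : DifferentiableAt ℝ Ψ (t, x)) :
    HasDerivAt (fun s => Ψ (s, x)) (fderiv ℝ Ψ (t, x) (1, 0)) t :=
  hΨ.hasFDerivAt.comp_hasDerivAt t ((hasDerivAt_id t).prodMk (hasDerivAt_const t x))

variable [InnerProductSpace ℝ X] [FiniteDimensional ℝ X]

/-- The Laplacian, in the second variable, of a family of maps `Ψ (t, ·)` depending on a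
parameter `t`. -/
def sliceLaplacian (Ψ : P × X → E) (p : P × X) : E :=
  Δ (fun y => Ψ (p.1, y)) p.2

theorem sliceLaplacian_eq_sum_fderiv_fderiv {ι : Type*} [Fintype ι] (b : OrthonormalBasis ι ℝ X)
    {Ψ : P × X → E} (hΨ : ContDiff ℝ ∞ Ψ) (p : P × X) :
    sliceLaplacian Ψ p = ∑ i, fderiv ℝ (fun q => fderiv ℝ Ψ q (0, b i)) p (0, b i) := by
  have hslice : ContDiff ℝ ∞ fun y => Ψ (p.1, y) := hΨ.comp (contDiff_const.prodMk contDiff_id)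
  rw [sliceLaplacian, laplacian_eq_sum_fderiv_fderiv b (contDiff_infty.1 hslice 2)]
  refine Finset.sum_congr rfl fun i _ => ?_
  simp only [fderiv_slice (hΨ.differentiable (by simp) _)]
  exact fderiv_slice ((contDiff_fderiv_apply hΨ _).differentiable (by simp) p) _

theorem contDiff_sliceLaplacian {Ψ : P × X → E} (hΨ : ContDiff ℝ ∞ Ψ) :
    ContDiff ℝ ∞ (sliceLaplacian Ψ) := by
  rw [funext (sliceLaplacian_eq_sum_fderiv_fderiv (stdOrthonormalBasis ℝ X) hΨ)]
  exact ContDiff.sum fun _ _ => contDiff_fderiv_apply (contDiff_fderiv_apply hΨ _) _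

theorem fderiv_sliceLaplacian {Ψ : P × X → E} (hΨ : ContDiff ℝ ∞ Ψ) (p v : P × X) :
    fderiv ℝ (sliceLaplacian Ψ) p v = sliceLaplacian (fun q => fderiv ℝ Ψ q v) p := by
  let b := stdOrthonormalBasis ℝ X
  have hΨ' := fun u => contDiff_fderiv_apply hΨ u
  rw [funext (sliceLaplacian_eq_sum_fderiv_fderiv b hΨ),
    sliceLaplacian_eq_sum_fderiv_fderiv b (hΨ' v),
    fderiv_fun_sum fun i _ => (contDiff_fderiv_apply (hΨ' _) _).differentiable (by simp) p,
    sum_apply]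
  refine Finset.sum_congr rfl fun i _ => ?_
  rw [fderiv_fderiv_apply_comm (contDiff_infty.1 (hΨ' _) 2)]
  simp only [fderiv_fderiv_apply_comm (contDiff_infty.1 hΨ 2) (0, b i) v]

theorem hasDerivAt_laplacian_slice {Ψ : ℝ × X → E} (hΨ : ContDiff ℝ ∞ Ψ) (t : ℝ) (x : X) :
    HasDerivAt (fun s => Δ (fun y => Ψ (s, y)) x)
      (Δ (fun y => deriv (fun s => Ψ (s, y)) t) x) t := by
  have hderiv : (fun y => deriv (fun s => Ψ (s, y)) t) = fun y => fderiv ℝ Ψ (t, y) (1, 0) :=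
    funext fun y => (hasDerivAt_slice (hΨ.differentiable (by simp) _)).deriv
  have h := hasDerivAt_slice ((contDiff_sliceLaplacian hΨ).differentiable (by simp) (t, x))
  rwa [fderiv_sliceLaplacian hΨ, sliceLaplacian, ← hderiv] at h

end Slices

section Integration

theorem measurableSet_fundamentalSquare (a : ℝ) : MeasurableSet (fundamentalSquare a) := by
  rw [fundamentalSquare, ofPred_forall]
  exact MeasurableSet.iInter fun i => measurableSet_Ico.preimage (by fun_prop)

theorem isBounded_fundamentalSquare (a : ℝ) : Bornology.IsBounded (fundamentalSquare a) := by
  have hbox : Bornology.IsBounded (pi univ fun _ : Fin 2 => Ico 0 (2 * Real.pi * a)) :=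
    Bornology.IsBounded.pi fun _ => Metric.isBounded_Ico _ _
  exact ((PiLp.antilipschitzWith_ofLp 2 fun _ : Fin 2 => ℝ).isBounded_preimage hbox).subset
    fun z hz i _ => hz i

theorem integrableOn_fundamentalSquare_of_continuous {E : Type*} [NormedAddCommGroup E]
    {g : Plane → E} (hg : Continuous g) (a : ℝ) : IntegrableOn g (fundamentalSquare a) :=
  (hg.continuousOn.integrableOn_compact (isBounded_fundamentalSquare a).isCompact_closure).mono_set
    subset_closure

theorem hasDerivAt_integral_fundamentalSquare (a : ℝ) {g : ℝ × Plane → ℝ} (hg : ContDiff ℝ 1 g)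
    (t₀ : ℝ) :
    HasDerivAt (fun t => ∫ z in fundamentalSquare a, g (t, z))
      (∫ z in fundamentalSquare a, deriv (fun t => g (t, z)) t₀) t₀ := by
  have hg' : Continuous fun p : ℝ × Plane => fderiv ℝ g p (1, 0) :=
    (hg.continuous_fderiv one_ne_zero).clm_apply continuous_const
  have hderiv : ∀ t z, HasDerivAt (fun s => g (s, z)) (fderiv ℝ g (t, z) (1, 0)) t := fun t z =>
    hasDerivAt_slice (hg.differentiable one_ne_zero _)
  obtain ⟨C, hC⟩ := ((isCompact_closedBall t₀ 1).prod
    (isBounded_fundamentalSquare a).isCompact_closure).exists_bound_of_continuousOn hg'.continuousOn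
  simp only [fun z => (hderiv t₀ z).deriv]
  refine (hasDerivAt_integral_of_dominated_loc_of_deriv_le (bound := fun _ => C)
    (F' := fun t z => fderiv ℝ g (t, z) (1, 0)) (Metric.closedBall_mem_nhds t₀ one_pos)
    (.of_forall fun t => ?_) ?_ ?_ ?_ ?_ ?_).2
  · exact (hg.continuous.comp (by fun_prop)).aestronglyMeasurable
  · exact integrableOn_fundamentalSquare_of_continuous (hg.continuous.comp (by fun_prop)) a
  · exact (hg'.comp (by fun_prop)).aestronglyMeasurable
  · filter_upwards [ae_restrict_mem (measurableSet_fundamentalSquare a)] with z hz t ht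
    exact hC (t, z) ⟨ht, subset_closure hz⟩
  · exact integrableOn_fundamentalSquare_of_continuous continuous_const a
  · exact .of_forall fun z t _ => hderiv t z

theorem smul_stdVec_mem_squareLattice (a : ℝ) (i : Fin 2) :
    (2 * Real.pi * a) • stdVec i ∈ squareLattice a :=
  ⟨Pi.single i 1, fun j => by simp [stdVec, Pi.single_apply]⟩

theorem integral_divergence_fundamentalSquare_eq_zero {a : ℝ} (ha : 0 < a) {X : Fin 2 → Plane → ℝ}
    (hX : ∀ i, ContDiff ℝ 1 (X i)) (hper : ∀ i, ∀ c ∈ squareLattice a, Function.Periodic (X i) c) :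
    ∫ z in fundamentalSquare a, ∑ i, fderiv ℝ (X i) z (stdVec i) = 0 := by
  let e := PiLp.continuousLinearEquiv 2 ℝ fun _ : Fin 2 => ℝ
  have hvol : MeasurePreserving e volume volume := PiLp.volume_preserving_ofLp (Fin 2)
  have hsquare : fundamentalSquare a = e ⁻¹' (pi univ fun _ => Ico 0 (2 * Real.pi * a)) := by
    ext z; simp [fundamentalSquare, e]
  have hdiv : Continuous fun z => ∑ i, fderiv ℝ (X i) z (stdVec i) :=
    continuous_finsetSum _ fun i _ =>
      ((hX i).continuous_fderiv one_ne_zero).clm_apply continuous_const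
  have hfaces := integral_divergence_of_hasFDerivAt_off_countable' (0 : Fin 2 → ℝ)
    (fun _ => 2 * Real.pi * a) (fun _ => by positivity) (fun i x => X i (e.symm x))
    (fun i x => fderiv ℝ (X i) (e.symm x) ∘L (e.symm : (Fin 2 → ℝ) →L[ℝ] Plane)) ∅ countable_empty
    (fun i => ((hX i).continuous.comp e.symm.continuous).continuousOn)
    (fun x _ i => ((hX i).differentiable one_ne_zero _).hasFDerivAt.comp x e.symm.hasFDerivAt)
    ((hdiv.comp e.symm.continuous).continuousOn.integrableOn_compact isCompact_Icc)
  calc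
    ∫ z in fundamentalSquare a, ∑ i, fderiv ℝ (X i) z (stdVec i)
      = ∫ x in pi univ fun _ => Ico 0 (2 * Real.pi * a),
          ∑ i, fderiv ℝ (X i) (e.symm x) (stdVec i) := by
        rw [hsquare, ← hvol.setIntegral_preimage_emb e.toHomeomorph.measurableEmbedding]
        simp
    _ = ∫ x in Icc (0 : Fin 2 → ℝ) (fun _ => 2 * Real.pi * a),
          ∑ i, fderiv ℝ (X i) (e.symm x) (stdVec i) :=
        setIntegral_congr_set Measure.univ_pi_Ico_ae_eq_Icc
    _ = 0 := by
        refine hfaces.trans (Finset.sum_eq_zero fun i _ => sub_eq_zero.2 ?_)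
        congr 1 with x
        refine Eq.trans ?_ (hper i _ (smul_stdVec_mem_squareLattice a i) _)
        congr 1
        ext j
        rcases Fin.eq_self_or_eq_succAbove i j with rfl | ⟨k, rfl⟩ <;> simp [e, stdVec]

theorem laplacian_eq_sum_stdVec {E : Type*} [NormedAddCommGroup E] [NormedSpace ℝ E]
    {G : Plane → E} (hG : ContDiff ℝ 2 G) (z : Plane) :
    Δ G z = ∑ i, fderiv ℝ (fun w => fderiv ℝ G w (stdVec i)) z (stdVec i) := by
  simp [laplacian_eq_sum_fderiv_fderiv (EuclideanSpace.basisFun (Fin 2) ℝ) hG, stdVec]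

variable {H : Type*} [NormedAddCommGroup H] [InnerProductSpace ℝ H]

theorem sum_fderiv_inner_sub_inner {V G : Plane → H} (hV : ContDiff ℝ ∞ V) (hG : ContDiff ℝ ∞ G)
    (z : Plane) :
    ∑ i, fderiv ℝ (fun w => ⟪fderiv ℝ V w (stdVec i), G w⟫ - ⟪V w, fderiv ℝ G w (stdVec i)⟫) z
      (stdVec i) = ⟪Δ V z, G z⟫ - ⟪V z, Δ G z⟫ := by
  have dV := hV.differentiable (by simp) z
  have dG := hG.differentiable (by simp) z
  have dV' := fun u => (contDiff_fderiv_apply hV u).differentiable (by simp) z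
  have dG' := fun u => (contDiff_fderiv_apply hG u).differentiable (by simp) z
  rw [laplacian_eq_sum_stdVec (contDiff_infty.1 hV 2),
    laplacian_eq_sum_stdVec (contDiff_infty.1 hG 2), sum_inner, inner_sum,
    ← Finset.sum_sub_distrib]
  refine Finset.sum_congr rfl fun i _ => ?_
  rw [fderiv_fun_sub ((dV' _).inner ℝ dG) (dV.inner ℝ (dG' _)), sub_apply,
    fderiv_inner_apply ℝ (dV' _) dG, fderiv_inner_apply ℝ dV (dG' _)]
  ring

theorem integral_inner_laplacian_comm {a : ℝ} (ha : 0 < a) {V G : Plane → H}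
    (hV : ContDiff ℝ ∞ V) (hG : ContDiff ℝ ∞ G)
    (hVper : ∀ c ∈ squareLattice a, Function.Periodic V c)
    (hGper : ∀ c ∈ squareLattice a, Function.Periodic G c) :
    ∫ z in fundamentalSquare a, ⟪Δ V z, G z⟫ = ∫ z in fundamentalSquare a, ⟪V z, Δ G z⟫ := by
  have hcont {A B : Plane → H} (hA : ContDiff ℝ ∞ A) (hB : ContDiff ℝ ∞ B) :
      IntegrableOn (fun z => ⟪A z, B z⟫) (fundamentalSquare a) :=
    integrableOn_fundamentalSquare_of_continuous (hA.continuous.inner hB.continuous) a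
  rw [← sub_eq_zero, ← integral_sub (hcont (contDiff_laplacian hV) hG)
    (hcont hV (contDiff_laplacian hG))]
  simp only [← sum_fderiv_inner_sub_inner hV hG]
  refine integral_divergence_fundamentalSquare_eq_zero ha (fun i => ?_) fun i c hc z => ?_
  · exact (((contDiff_fderiv_apply hV _).inner ℝ hG).sub
      (hV.inner ℝ (contDiff_fderiv_apply hG _))).of_le (mod_cast le_top)
  · simp only [periodic_fderiv (hVper c hc) z, periodic_fderiv (hGper c hc) z, hVper c hc z,
      hGper c hc z]

end Integration

section TensionField

variable {a : ℝ} {n : ℕ}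

theorem inner_fderiv_apply_eq_zero_of_norm_eq {X H : Type*} [NormedAddCommGroup X]
    [NormedSpace ℝ X] [NormedAddCommGroup H] [InnerProductSpace ℝ H] {G : X → H} {r : ℝ} {x : X}
    (hG : DifferentiableAt ℝ G x) (hr : ∀ y, ‖G y‖ = r) (u : X) :
    ⟪fderiv ℝ G x u, G x⟫ = 0 := by
  have hconst : (fun y => ⟪G y, G y⟫) = fun _ => r ^ 2 := by simp [hr]
  have h := fderiv_inner_apply ℝ hG hG u
  rw [hconst, fderiv_const_apply, zero_apply, real_inner_comm] at h
  linarith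

theorem norm_lift (φ : SquareTorus a → UnitSphere n) (z : Plane) : ‖lift φ z‖ = 1 := by
  simp [lift]

theorem inner_lift_self (φ : SquareTorus a → UnitSphere n) (z : Plane) :
    ⟪lift φ z, lift φ z⟫ = 1 := by
  rw [real_inner_self_eq_norm_sq, norm_lift, one_pow]

theorem periodic_lift (φ : SquareTorus a → UnitSphere n) {c : Plane} (hc : c ∈ squareLattice a) :
    Function.Periodic (lift φ) c := fun z => by
  simp [lift, (QuotientAddGroup.eq_zero_iff c).2 hc]

theorem exists_lift_eq {F : Plane → Ambient n} (hnorm : ∀ z, ‖F z‖ = 1)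
    (hper : ∀ c ∈ squareLattice a, Function.Periodic F c) :
    ∃ φ : SquareTorus a → UnitSphere n, lift φ = F := by
  let sphereMap (z : Plane) : UnitSphere n := ⟨F z, by simp [hnorm]⟩
  have hcoset (z w : Plane) (h : QuotientAddGroup.leftRel (squareLattice a) z w) :
      sphereMap z = sphereMap w := by
    rw [QuotientAddGroup.leftRel_apply] at h
    exact Subtype.ext (by simpa using (hper _ h z).symm)
  exact ⟨fun x => Quotient.liftOn' x sphereMap hcoset, rfl⟩

/-- The squared norm `|dφ|²` of the differential, that is, twice the energy density. -/
def sqNormDifferential (φ : SquareTorus a → UnitSphere n) (z : Plane) : ℝ :=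
  ∑ i, ‖fderiv ℝ (lift φ) z (stdVec i)‖ ^ 2

variable {φ : SquareTorus a → UnitSphere n}

theorem contDiff_sqNormDifferential (hφ : IsSmoothMap φ) : ContDiff ℝ ∞ (sqNormDifferential φ) :=
  ContDiff.sum fun _ _ => (contDiff_fderiv_apply hφ _).norm_sq ℝ

theorem inner_fderiv_lift (hφ : IsSmoothMap φ) (z u : Plane) :
    ⟪fderiv ℝ (lift φ) z u, lift φ z⟫ = 0 :=
  inner_fderiv_apply_eq_zero_of_norm_eq (hφ.differentiable (by simp) z) (norm_lift φ) u

theorem inner_laplacian_lift (hφ : IsSmoothMap φ) (z : Plane) :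
    ⟪Δ (lift φ) z, lift φ z⟫ = -sqNormDifferential φ z := by
  have hpart (i : Fin 2) :
      ⟪fderiv ℝ (fun w => fderiv ℝ (lift φ) w (stdVec i)) z (stdVec i), lift φ z⟫ =
        -‖fderiv ℝ (lift φ) z (stdVec i)‖ ^ 2 := by
    have hd := (contDiff_fderiv_apply hφ (stdVec i)).differentiable (by simp) z
    have h := fderiv_inner_apply ℝ hd (hφ.differentiable (by simp) z) (stdVec i)
    simp only [inner_fderiv_lift hφ, fderiv_const_apply, zero_apply,
      real_inner_self_eq_norm_sq] at h
    linarith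
  rw [laplacian_eq_sum_stdVec (contDiff_infty.1 hφ 2), sum_inner, sqNormDifferential,
    ← Finset.sum_neg_distrib]
  exact Finset.sum_congr rfl fun i _ => hpart i

theorem tension_eq (hφ : IsSmoothMap φ) (z : Plane) :
    tension φ z = Δ (lift φ) z + sqNormDifferential φ z • lift φ z := by
  have h : tension φ z = Δ (lift φ) z - ⟪Δ (lift φ) z, lift φ z⟫ • lift φ z := by
    simp only [laplacian_eq_sum_stdVec (contDiff_infty.1 hφ 2), tension, hessian, covDeriv,
      Finset.sum_sub_distrib, sum_inner, Finset.sum_smul]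
  rw [h, inner_laplacian_lift hφ, neg_smul, sub_neg_eq_add]

theorem inner_tension_lift (hφ : IsSmoothMap φ) (z : Plane) : ⟪tension φ z, lift φ z⟫ = 0 := by
  rw [tension_eq hφ, inner_add_left, inner_laplacian_lift hφ, real_inner_smul_left,
    inner_lift_self, mul_one, neg_add_cancel]

theorem norm_tension_sq (hφ : IsSmoothMap φ) (z : Plane) :
    ‖tension φ z‖ ^ 2 = ⟪Δ (lift φ) z, Δ (lift φ) z⟫ - ⟪Δ (lift φ) z, lift φ z⟫ ^ 2 := by
  rw [← real_inner_self_eq_norm_sq]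
  nth_rewrite 2 [tension_eq hφ]
  rw [inner_add_right, real_inner_smul_right, inner_tension_lift hφ, tension_eq hφ, inner_add_left,
    real_inner_smul_left, real_inner_comm (Δ (lift φ) z) (lift φ z), inner_laplacian_lift hφ]
  ring

theorem contDiff_tension (hφ : IsSmoothMap φ) : ContDiff ℝ ∞ (tension φ) := by
  rw [funext (tension_eq hφ)]
  exact (contDiff_laplacian hφ).add ((contDiff_sqNormDifferential hφ).smul hφ)

theorem periodic_tension (hφ : IsSmoothMap φ) {c : Plane} (hc : c ∈ squareLattice a) :
    Function.Periodic (tension φ) c := fun z => by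
  have hper := periodic_lift φ hc
  simp only [tension_eq hφ, sqNormDifferential, periodic_laplacian hper z, periodic_fderiv hper z,
    hper z]

/-- The bitension field `τ₂(φ) = trace ∇²τ(φ) - trace R(dφ, τ(φ))dφ`, where `R` is the curvature
tensor of the sphere. The terms tangent to `dφ` of the two traces cancel, and what is left is the
projection of `Δτ(φ) + |dφ|² τ(φ)` to the tangent space of the sphere. -/
def bitension (φ : SquareTorus a → UnitSphere n) (z : Plane) : Ambient n :=
  Δ (tension φ) z - ⟪Δ (tension φ) z, lift φ z⟫ • lift φ z + sqNormDifferential φ z • tension φ z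

theorem bitension_eq_zero_of_eq_smul (hφ : IsSmoothMap φ) {z : Plane} {c : ℝ}
    (h : Δ (tension φ) z + sqNormDifferential φ z • tension φ z = c • lift φ z) :
    bitension φ z = 0 := by
  have hinner : ⟪Δ (tension φ) z, lift φ z⟫ = c := by
    rw [eq_sub_of_add_eq h, inner_sub_left, real_inner_smul_left, real_inner_smul_left,
      inner_tension_lift hφ, inner_lift_self, mul_one, mul_zero, sub_zero]
  rw [bitension, hinner, sub_add_eq_add_sub, h, sub_self]

end TensionField

section FirstVariation

variable {a : ℝ} {n : ℕ}

/-- The variation field `V = dΦ_t/dt` at time `0` of a variation of a map to the sphere. -/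
def variationField (Φ : ℝ → SquareTorus a → UnitSphere n) (z : Plane) : Ambient n :=
  deriv (fun t => lift (Φ t) z) 0

theorem periodic_variationField (Φ : ℝ → SquareTorus a → UnitSphere n) {c : Plane}
    (hc : c ∈ squareLattice a) : Function.Periodic (variationField Φ) c := fun z => by
  simp only [variationField, periodic_lift _ hc z]

variable {φ : SquareTorus a → UnitSphere n} {Φ : ℝ → SquareTorus a → UnitSphere n}

theorem IsSmoothVariation.isSmoothMap (hΦ : IsSmoothVariation φ Φ) (t : ℝ) : IsSmoothMap (Φ t) :=
  hΦ.1.comp (contDiff_const.prodMk contDiff_id)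

theorem IsSmoothVariation.hasDerivAt (hΦ : IsSmoothVariation φ Φ) (z : Plane) :
    HasDerivAt (fun t => lift (Φ t) z) (variationField Φ z) 0 :=
  (hasDerivAt_slice (hΦ.1.differentiable (by simp) (0, z))).differentiableAt.hasDerivAt

theorem IsSmoothVariation.hasDerivAt_laplacian (hΦ : IsSmoothVariation φ Φ) (z : Plane) :
    HasDerivAt (fun t => Δ (lift (Φ t)) z) (Δ (variationField Φ) z) 0 :=
  hasDerivAt_laplacian_slice hΦ.1 0 z

theorem IsSmoothVariation.contDiff_variationField (hΦ : IsSmoothVariation φ Φ) :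
    ContDiff ℝ ∞ (variationField Φ) := by
  have h (z : Plane) : variationField Φ z =
      fderiv ℝ (fun p : ℝ × Plane => lift (Φ p.1) p.2) (0, z) (1, 0) :=
    (hasDerivAt_slice (hΦ.1.differentiable (by simp) (0, z))).deriv
  rw [funext h]
  exact (contDiff_fderiv_apply hΦ.1 _).comp (contDiff_const.prodMk contDiff_id)

theorem IsSmoothVariation.inner_variationField (hΦ : IsSmoothVariation φ Φ) (z : Plane) :
    ⟪variationField Φ z, lift φ z⟫ = 0 := by
  obtain rfl := hΦ.2
  exact inner_fderiv_apply_eq_zero_of_norm_eq (hΦ.hasDerivAt z).differentiableAt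
    (fun t => norm_lift (Φ t) z) 1

theorem IsSmoothVariation.hasDerivAt_norm_tension_sq (hΦ : IsSmoothVariation φ Φ) (z : Plane) :
    HasDerivAt (fun t => ‖tension (Φ t) z‖ ^ 2)
      (2 * (⟪Δ (variationField Φ) z, tension φ z⟫ +
        sqNormDifferential φ z * ⟪variationField Φ z, tension φ z⟫)) 0 := by
  have hL := hΦ.hasDerivAt_laplacian z
  have hderiv := (hL.inner ℝ hL).sub ((hL.inner ℝ (hΦ.hasDerivAt z)).pow 2)
  have hV := hΦ.inner_variationField z
  obtain rfl := hΦ.2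
  simp only [norm_tension_sq (hΦ.isSmoothMap _)]
  refine hderiv.congr_deriv ?_
  rw [inner_laplacian_lift (hΦ.isSmoothMap 0), tension_eq (hΦ.isSmoothMap 0), inner_add_right,
    inner_add_right, real_inner_smul_right, real_inner_smul_right, hV,
    real_inner_comm (Δ (variationField Φ) z), real_inner_comm (variationField Φ z)]
  simp only [Nat.cast_ofNat, Nat.add_one_sub_one, pow_one]
  ring

theorem IsSmoothVariation.hasDerivAt_integral_norm_tension_sq (hΦ : IsSmoothVariation φ Φ) :
    HasDerivAt (fun t => ∫ z in fundamentalSquare a, ‖tension (Φ t) z‖ ^ 2)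
      (∫ z in fundamentalSquare a, 2 * (⟪Δ (variationField Φ) z, tension φ z⟫ +
        sqNormDifferential φ z * ⟪variationField Φ z, tension φ z⟫)) 0 := by
  have hLaplacian := contDiff_sliceLaplacian hΦ.1
  have hdensity : ContDiff ℝ ∞ fun p : ℝ × Plane => ‖tension (Φ p.1) p.2‖ ^ 2 := by
    simp only [norm_tension_sq (hΦ.isSmoothMap _)]
    exact (hLaplacian.inner ℝ hLaplacian).sub ((hLaplacian.inner ℝ hΦ.1).pow 2)
  simpa only [fun z => (hΦ.hasDerivAt_norm_tension_sq z).deriv] using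
    hasDerivAt_integral_fundamentalSquare a (contDiff_infty.1 hdensity 1) 0

theorem IsSmoothVariation.hasDerivAt_bienergy (ha : 0 < a) (hΦ : IsSmoothVariation φ Φ) :
    HasDerivAt (fun t => bienergy (Φ t))
      (∫ z in fundamentalSquare a, ⟪variationField Φ z, bitension φ z⟫) 0 := by
  have hφ : IsSmoothMap φ := hΦ.2 ▸ hΦ.isSmoothMap 0
  have hV := hΦ.contDiff_variationField
  have hτ := contDiff_tension hφ
  have hnormal (z : Plane) : ⟪variationField Φ z, bitension φ z⟫ =
      ⟪variationField Φ z, Δ (tension φ) z⟫ +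
        sqNormDifferential φ z * ⟪variationField Φ z, tension φ z⟫ := by
    rw [bitension, inner_add_right, inner_sub_right, real_inner_smul_right, real_inner_smul_right,
      hΦ.inner_variationField, mul_zero, sub_zero]
  have hintegrable {g : Plane → ℝ} (hg : ContDiff ℝ ∞ g) : IntegrableOn g (fundamentalSquare a) :=
    integrableOn_fundamentalSquare_of_continuous hg.continuous a
  have hintΔV := hintegrable ((contDiff_laplacian hV).inner ℝ hτ)
  have hintΔτ := hintegrable (hV.inner ℝ (contDiff_laplacian hτ))
  have hintVτ := hintegrable ((contDiff_sqNormDifferential hφ).mul (hV.inner ℝ hτ))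
  refine (hΦ.hasDerivAt_integral_norm_tension_sq.const_mul (1 / 2)).congr_deriv ?_
  simp only [hnormal]
  rw [integral_const_mul, integral_add hintΔV hintVτ, integral_add hintΔτ hintVτ,
    integral_inner_laplacian_comm ha hV hτ (fun c hc => periodic_variationField Φ hc)
      fun c hc => periodic_tension hφ hc]
  ring

theorem isBiharmonicMap_of_bitension_eq_zero (ha : 0 < a) (hφ : IsSmoothMap φ)
    (hbi : ∀ z, bitension φ z = 0) : IsBiharmonicMap φ :=
  ⟨hφ, fun _ hΦ => by
    simpa only [hbi, inner_zero_right, integral_zero] using hΦ.hasDerivAt_bienergy ha⟩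

end FirstVariation

section RiemannianImmersions

variable {a : ℝ} {n : ℕ} {φ : SquareTorus a → UnitSphere n}

theorem IsRiemannianImmersion.sqNormDifferential_eq (hφ : IsRiemannianImmersion φ) (z : Plane) :
    sqNormDifferential φ z = 2 := by
  have hunit (i : Fin 2) : ‖fderiv ℝ (lift φ) z (stdVec i)‖ ^ 2 = 1 := by
    rw [← real_inner_self_eq_norm_sq, hφ.2]
    simp [stdVec]
  simp [sqNormDifferential, hunit]

theorem IsRiemannianImmersion.inner_fderiv_fderiv (hφ : IsRiemannianImmersion φ)
    (z u v w : Plane) :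
    ⟪fderiv ℝ (fun y => fderiv ℝ (lift φ) y v) z u, fderiv ℝ (lift φ) z w⟫ = 0 := by
  let S (u v w : Plane) : ℝ :=
    ⟪fderiv ℝ (fun y => fderiv ℝ (lift φ) y v) z u, fderiv ℝ (lift φ) z w⟫
  have hsymm (u v w : Plane) : S u v w = S v u w := by
    simp only [S, fderiv_fderiv_apply_comm (contDiff_infty.1 hφ.1 2) v u z]
  have hskew (u v w : Plane) : S u v w = -S u w v := by
    have hd := fun v => (contDiff_fderiv_apply hφ.1 v).differentiable (by simp) z
    have h := fderiv_inner_apply ℝ (hd v) (hd w) u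
    simp only [hφ.2, fderiv_const_apply, zero_apply] at h
    rw [real_inner_comm] at h
    simp only [S]
    linarith
  -- A trilinear form symmetric in two slots and skew in two others vanishes.
  have : S u v w = -S u v w :=
    calc
      S u v w = -S w u v := by rw [hskew, hsymm]
      _ = S v w u := by rw [hskew, hsymm, neg_neg]
      _ = -S u v w := by rw [hskew, hsymm]
  exact self_eq_neg.1 this

theorem IsRiemannianImmersion.secondFundamentalForm_eq (hφ : IsRiemannianImmersion φ)
    (z u v : Plane) : secondFundamentalForm φ z u v = hessian φ z u v := by
  refine Submodule.starProjection_eq_self_iff.2 ((Submodule.mem_orthogonal' _ _).2 ?_)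
  rintro _ ⟨w, rfl⟩
  rw [hessian, covDeriv, inner_sub_left, real_inner_smul_left, real_inner_comm _ (lift φ z)]
  simp [hφ.inner_fderiv_fderiv, inner_fderiv_lift hφ.1]

theorem IsRiemannianImmersion.meanCurvatureVector_eq (hφ : IsRiemannianImmersion φ) (z : Plane) :
    meanCurvatureVector φ z = (1 / 2 : ℝ) • tension φ z := by
  simp only [meanCurvatureVector, tension, hφ.secondFundamentalForm_eq]

theorem IsRiemannianImmersion.isCMC_of_norm_tension_sq (hφ : IsRiemannianImmersion φ) {c : ℝ}
    (hc : ∀ z, ‖tension φ z‖ ^ 2 = c) : IsCMC φ :=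
  ⟨√c / 2, fun z => by
    rw [hφ.meanCurvatureVector_eq, norm_smul, ← hc z, Real.sqrt_sq (norm_nonneg _)]
    norm_num
    ring⟩

end RiemannianImmersions

section PlaneWaves

open Complex ComplexConjugate

variable {X ι : Type*} [NormedAddCommGroup X] [InnerProductSpace ℝ X]

/-- The superposition of plane waves with frequencies `f k` and complex amplitudes `A k`, each in
its own complex coordinate. -/
def planeWave (f : ι → X) (A : ι → ℂ) (z : X) : EuclideanSpace ℂ ι :=
  WithLp.toLp 2 fun k => A k * cexp (⟪f k, z⟫ * I)

variable (f : ι → X)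

theorem planeWave_add (A B : ι → ℂ) (z : X) :
    planeWave f (A + B) z = planeWave f A z + planeWave f B z := by
  ext k
  simp [planeWave, add_mul]

theorem planeWave_smul (r : ℝ) (A : ι → ℂ) (z : X) :
    planeWave f (r • A) z = r • planeWave f A z := by
  ext k
  simp [planeWave, mul_assoc]

theorem periodic_planeWave {c : X} (hc : ∀ k, cexp (⟪f k, c⟫ * I) = 1) (A : ι → ℂ) :
    Function.Periodic (planeWave f A) c := fun z => by
  ext k
  simp [planeWave, inner_add_right, add_mul, exp_add, hc]

theorem inner_planeWave [Fintype ι] (A B : ι → ℂ) (z : X) :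
    ⟪planeWave f A z, planeWave f B z⟫ = ∑ k, ⟪A k, B k⟫ := by
  rw [PiLp.inner_apply]
  refine Finset.sum_congr rfl fun k _ => ?_
  simp only [planeWave, Complex.inner, map_mul, ← exp_conj, conj_ofReal, conj_I]
  rw [mul_mul_mul_comm, ← exp_add]
  simp

theorem contDiff_planeWave [Fintype ι] (A : ι → ℂ) : ContDiff ℝ ∞ (planeWave f A) := by
  refine (contDiff_piLp 2).2 fun k => contDiff_const.mul (ContDiff.cexp ?_)
  exact (ofRealCLM.contDiff.comp (contDiff_const.inner ℝ contDiff_id)).mul contDiff_const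

theorem fderiv_planeWave [Finite ι] (A : ι → ℂ) (z u : X) :
    fderiv ℝ (planeWave f A) z u = planeWave f (fun k => ⟪f k, u⟫ * I * A k) z := by
  have := Fintype.ofFinite ι
  ext k
  have hphase : HasFDerivAt (fun w => (⟪f k, w⟫ : ℂ) * I) _ z :=
    (ofRealCLM.hasFDerivAt.comp z (innerSL ℝ (f k)).hasFDerivAt).mul_const I
  have hcoord : HasFDerivAt (fun w => planeWave f A w k) _ z := hphase.cexp.const_mul (A k)
  have hcoord' : HasFDerivAt (fun w => planeWave f A w k) _ z :=
    (PiLp.proj (𝕜 := ℝ) 2 (fun _ : ι => ℂ) k).hasFDerivAt.comp z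
      ((contDiff_planeWave f A).differentiable (by simp) z).hasFDerivAt
  refine (DFunLike.congr_fun (hcoord'.unique hcoord) u).trans ?_
  simp only [planeWave, smul_apply, ContinuousLinearMap.comp_apply, innerSL_apply_apply,
    ofRealCLM_apply, smul_eq_mul]
  ring

theorem laplacian_planeWave [Fintype ι] [FiniteDimensional ℝ X] (A : ι → ℂ) (z : X) :
    Δ (planeWave f A) z = planeWave f (fun k => -(‖f k‖ ^ 2 : ℝ) * A k) z := by
  let b := stdOrthonormalBasis ℝ X
  rw [laplacian_eq_sum_fderiv_fderiv b (contDiff_infty.1 (contDiff_planeWave f A) 2)]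
  simp only [fderiv_planeWave]
  ext k
  have hnorm : ((‖f k‖ ^ 2 : ℝ) : ℂ) = ∑ i, (⟪f k, b i⟫ : ℂ) * ⟪f k, b i⟫ := by
    rw [← real_inner_self_eq_norm_sq, ← b.sum_inner_mul_inner]
    simp [real_inner_comm]
  simp only [planeWave, hnorm, WithLp.ofLp_sum, Finset.sum_apply, ← Finset.sum_neg_distrib,
    Finset.sum_mul]
  refine Finset.sum_congr rfl fun i _ => ?_
  linear_combination (⟪f k, b i⟫ : ℂ) * ⟪f k, b i⟫ * A k * cexp (⟪f k, z⟫ * I) * I_mul_I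

/-- The character `z ↦ exp(i⟪g, z⟫)`. -/
def waveChar (g : X) : Multiplicative X →* ℂ where
  toFun z := cexp (⟪g, z.toAdd⟫ * I)
  map_one' := by simp
  map_mul' x y := by simp [inner_add_right, add_mul, exp_add]

theorem waveChar_injective : Function.Injective (waveChar (X := X)) := fun g h hgh => by
  by_contra hne
  have hd : ‖g - h‖ ^ 2 ≠ 0 := by simpa [sub_eq_zero] using hne
  -- The two characters differ by the factor `exp(iπ) = -1` at `z`.
  let z := (Real.pi / ‖g - h‖ ^ 2) • (g - h)
  have hz : ⟪g, z⟫ = ⟪h, z⟫ + Real.pi := by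
    rw [← sub_eq_iff_eq_add', ← inner_sub_left, real_inner_smul_right, real_inner_self_eq_norm_sq,
      div_mul_cancel₀ _ hd]
  have hchar : cexp (⟪g, z⟫ * I) = cexp (⟪h, z⟫ * I) :=
    DFunLike.congr_fun hgh (Multiplicative.ofAdd z)
  rw [hz, ofReal_add, add_mul, exp_add, exp_pi_mul_I, mul_neg_one] at hchar
  exact exp_ne_zero _ (self_eq_neg.1 hchar.symm)

theorem linearIndependent_waveChar {κ : Type*} {g : κ → X} (hg : Function.Injective g) :
    LinearIndependent ℂ fun k z => cexp (⟪g k, z⟫ * I) :=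
  (linearIndependent_monoidHom (Multiplicative X) ℂ).comp _ (waveChar_injective.comp hg)

variable {f}

theorem span_range_planeWave_eq_top [Finite ι] (hf : Function.Injective (Sum.elim f (-f)))
    {A : ι → ℂ} (hA : ∀ k, A k ≠ 0) : Submodule.span ℝ (range (planeWave f A)) = ⊤ := by
  have := Fintype.ofFinite ι
  rw [← Submodule.orthogonal_eq_bot_iff, Submodule.eq_bot_iff]
  intro c hc
  let wave (k : ι) (z : X) : ℂ := A k * cexp (⟪f k, z⟫ * I) * conj (c k)
  have hre (z : X) : ∑ k, (wave k z).re = 0 := by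
    have h := (Submodule.mem_orthogonal' _ _).1 hc _ (Submodule.subset_span (mem_range_self z))
    simpa only [PiLp.inner_apply, planeWave, Complex.inner] using h
  have hcharacters (k : ι) (z : X) :
      conj (c k) * A k * cexp (⟪f k, z⟫ * I) + c k * conj (A k) * cexp (⟪-f k, z⟫ * I) =
        (2 * (wave k z).re : ℝ) := by
    rw [← add_conj]
    simp only [wave, map_mul, ← exp_conj, conj_ofReal, conj_I, conj_conj, inner_neg_left,
      ofReal_neg, neg_mul, mul_neg]
    ring
  have hcoef := Fintype.linearIndependent_iff.1 (linearIndependent_waveChar hf)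
    (Sum.elim (fun k => conj (c k) * A k) fun k => c k * conj (A k)) (by
      ext z
      rw [Finset.sum_apply, Fintype.sum_sum_type, ← Finset.sum_add_distrib]
      refine (Finset.sum_congr rfl fun k _ => hcharacters k z).trans ?_
      rw [← ofReal_sum, ← Finset.mul_sum, hre, mul_zero, ofReal_zero, Pi.zero_apply])
  ext k
  simpa [hA k] using hcoef (Sum.inl k)

end PlaneWaves

section WaveImmersions

variable {ι : Type*} [Fintype ι] {a c : ℝ} {n : ℕ} {f : ι → Plane} {w : ι → ℝ}

/-- Frequencies `f` with weights `w` for which the superposition of plane waves of amplitudes `√w`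
is a proper-biharmonic immersion of the torus `ℝ² / 2πaℤ²`. The condition on the norms says that
the Laplacian of this superposition has at most the two eigenvalues `-2 ± √c`. -/
structure IsProperBiharmonicSystem (a c : ℝ) (f : ι → Plane) (w : ι → ℝ) : Prop where
  pos : 0 < a
  ne_zero : c ≠ 0
  weight_pos : ∀ k, 0 < w k
  sum_weight : ∑ k, w k = 1
  isotropic : ∀ u v, ∑ k, w k * (⟪f k, u⟫ * ⟪f k, v⟫) = ⟪u, v⟫
  dual : ∀ k i, ∃ l : ℤ, a * f k i = l
  injective : Function.Injective (Sum.elim f (-f))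
  norm_sq : ∀ k, (‖f k‖ ^ 2 - 2) ^ 2 = c

theorem cexp_inner_eq_one_of_mem_squareLattice {g z : Plane} (hg : ∀ i, ∃ l : ℤ, a * g i = l)
    (hz : z ∈ squareLattice a) : Complex.exp (⟪g, z⟫ * Complex.I) = 1 := by
  choose l hl using hg
  obtain ⟨m, hm⟩ := hz
  refine Complex.exp_eq_one_iff.2 ⟨∑ i, l i * m i, ?_⟩
  have hinner : ⟪g, z⟫ = (∑ i, l i * m i : ℤ) * (2 * Real.pi) := by
    simp only [PiLp.inner_apply, hm, RCLike.inner_apply, conj_trivial, Int.cast_sum, Int.cast_mul,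
      ← hl, Finset.sum_mul]
    exact Finset.sum_congr rfl fun i _ => by ring
  rw [hinner]
  push_cast
  ring

theorem inner_planeWave_sqrt (hw : ∀ k, 0 ≤ w k) (A B : ι → ℂ) (z : Plane) :
    ⟪planeWave f (fun k => A k * √(w k)) z, planeWave f (fun k => B k * √(w k)) z⟫ =
      ∑ k, w k * ⟪A k, B k⟫ := by
  rw [inner_planeWave]
  refine Finset.sum_congr rfl fun k _ => ?_
  rw [mul_comm (A k), mul_comm (B k), ← Complex.real_smul, ← Complex.real_smul,
    real_inner_smul_left, real_inner_smul_right, ← mul_assoc, Real.mul_self_sqrt (hw k)]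

theorem laplacian_isometry_comp_planeWave (T : EuclideanSpace ℂ ι ≃ₗᵢ[ℝ] Ambient n) (A : ι → ℂ)
    (z : Plane) :
    Δ (T ∘ planeWave f A) z = T (planeWave f (fun k => -(‖f k‖ ^ 2 : ℝ) * A k) z) := by
  rw [← laplacian_planeWave]
  exact congrFun (InnerProductSpace.laplacian_CLE_comp_left (l := T.toContinuousLinearEquiv)) z

namespace IsProperBiharmonicSystem

variable {T : EuclideanSpace ℂ ι ≃ₗᵢ[ℝ] Ambient n} {φ : SquareTorus a → UnitSphere n}

theorem norm_planeWave (S : IsProperBiharmonicSystem a c f w) (z : Plane) :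
    ‖planeWave f (fun k => √(w k)) z‖ = 1 := by
  have h := inner_planeWave_sqrt (f := f) (fun k => (S.weight_pos k).le) 1 1 z
  simp only [Pi.one_apply, one_mul, real_inner_self_eq_norm_sq, norm_one, one_pow, mul_one,
    S.sum_weight] at h
  exact (pow_eq_one_iff_of_nonneg (norm_nonneg _) two_ne_zero).1 h

theorem exists_lift_eq (S : IsProperBiharmonicSystem a c f w)
    (T : EuclideanSpace ℂ ι ≃ₗᵢ[ℝ] Ambient n) :
    ∃ φ : SquareTorus a → UnitSphere n, lift φ = T ∘ planeWave f (fun k => √(w k)) :=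
  SquareTorusImmersion.exists_lift_eq (fun z => (T.norm_map _).trans (S.norm_planeWave z))
    fun _ hc => (periodic_planeWave f
      (fun k => cexp_inner_eq_one_of_mem_squareLattice (S.dual k) hc) _).comp T

theorem isRiemannianImmersion (S : IsProperBiharmonicSystem a c f w)
    (hφ : lift φ = T ∘ planeWave f (fun k => √(w k))) : IsRiemannianImmersion φ := by
  refine ⟨by rw [IsSmoothMap, hφ]; exact T.contDiff.comp (contDiff_planeWave f _), fun z u v => ?_⟩
  rw [hφ, T.comp_fderiv, ← S.isotropic u v]
  change ⟪T (fderiv ℝ (planeWave f fun k => √(w k)) z u),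
    T (fderiv ℝ (planeWave f fun k => √(w k)) z v)⟫ = _
  rw [T.inner_map_map, fderiv_planeWave, fderiv_planeWave,
    inner_planeWave_sqrt fun k => (S.weight_pos k).le]
  simp [Complex.inner, mul_comm]

theorem isFull (S : IsProperBiharmonicSystem a c f w)
    (hφ : lift φ = T ∘ planeWave f (fun k => √(w k))) : IsFull φ := fun W hW => by
  have hspan : Submodule.span ℝ (range (planeWave f fun k => √(w k))) ≤
      W.comap T.toLinearEquiv.toLinearMap := by
    refine Submodule.span_le.2 ?_
    rintro _ ⟨z, rfl⟩
    have hz : lift φ z ∈ W := hW (QuotientAddGroup.mk z)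
    rwa [hφ] at hz
  have hne (k : ι) : (√(w k) : ℂ) ≠ 0 :=
    Complex.ofReal_ne_zero.2 (Real.sqrt_pos.2 (S.weight_pos k)).ne'
  rw [span_range_planeWave_eq_top S.injective hne] at hspan
  exact Submodule.eq_top_iff'.2 fun y => by simpa using hspan (Submodule.mem_top (x := T.symm y))

theorem tension_eq (S : IsProperBiharmonicSystem a c f w)
    (hφ : lift φ = T ∘ planeWave f (fun k => √(w k))) (z : Plane) :
    tension φ z = T (planeWave f (fun k => (2 - ‖f k‖ ^ 2 : ℝ) * √(w k)) z) := by
  have himm := S.isRiemannianImmersion hφ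
  rw [SquareTorusImmersion.tension_eq himm.1, himm.sqNormDifferential_eq, hφ,
    laplacian_isometry_comp_planeWave, Function.comp_apply, ← T.map_smul, ← T.map_add,
    ← planeWave_smul, ← planeWave_add]
  congr 2
  ext k
  simp
  ring

theorem norm_tension_sq (S : IsProperBiharmonicSystem a c f w)
    (hφ : lift φ = T ∘ planeWave f (fun k => √(w k))) (z : Plane) : ‖tension φ z‖ ^ 2 = c := by
  rw [S.tension_eq hφ, T.norm_map, ← real_inner_self_eq_norm_sq,
    inner_planeWave_sqrt fun k => (S.weight_pos k).le]
  have hterm (k : ι) : w k * ⟪((2 - ‖f k‖ ^ 2 : ℝ) : ℂ), ((2 - ‖f k‖ ^ 2 : ℝ) : ℂ)⟫ = w k * c := by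
    rw [real_inner_self_eq_norm_sq, Complex.norm_real, Real.norm_eq_abs, sq_abs, ← S.norm_sq k,
      sub_sq_comm]
  simp only [hterm, ← Finset.sum_mul, S.sum_weight, one_mul]

theorem bitension_eq_zero (S : IsProperBiharmonicSystem a c f w)
    (hφ : lift φ = T ∘ planeWave f (fun k => √(w k))) (z : Plane) : bitension φ z = 0 := by
  have himm := S.isRiemannianImmersion hφ
  have hτ : tension φ = T ∘ planeWave f (fun k => (2 - ‖f k‖ ^ 2 : ℝ) * √(w k)) :=
    funext (S.tension_eq hφ)
  refine bitension_eq_zero_of_eq_smul himm.1 (c := c) ?_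
  rw [himm.sqNormDifferential_eq, hτ, hφ, laplacian_isometry_comp_planeWave, Function.comp_apply,
    Function.comp_apply, ← T.map_smul, ← T.map_smul, ← T.map_add, ← planeWave_smul,
    ← planeWave_smul, ← planeWave_add]
  congr 2
  ext k
  simp [← S.norm_sq k]
  ring

theorem exists_isProperBiharmonic (S : IsProperBiharmonicSystem a c f w)
    (hn : 2 * Fintype.card ι = n + 1) :
    ∃ φ : SquareTorus a → UnitSphere n,
      IsRiemannianImmersion φ ∧ IsFull φ ∧ IsCMC φ ∧ IsProperBiharmonic φ := by
  have hdim : Module.finrank ℝ (EuclideanSpace ℂ ι) = n + 1 := by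
    rw [finrank_real_of_complex, finrank_euclideanSpace, hn]
  obtain ⟨φ, hφ⟩ := S.exists_lift_eq ((stdOrthonormalBasis ℝ _).reindex (finCongr hdim)).repr
  have himm := S.isRiemannianImmersion hφ
  have hτ := S.norm_tension_sq hφ
  refine ⟨φ, himm, S.isFull hφ, himm.isCMC_of_norm_tension_sq hτ,
    isBiharmonicMap_of_bitension_eq_zero S.pos himm.1 (S.bitension_eq_zero hφ), fun hharm => ?_⟩
  exact S.ne_zero (by rw [← hτ 0, hharm, norm_zero, zero_pow two_ne_zero])

end IsProperBiharmonicSystem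

end WaveImmersions

section Frequencies

theorem exists_common_denominator {κ : Type*} [Finite κ] (r : κ → ℚ) :
    ∃ D : ℕ, 0 < D ∧ ∀ i, ∃ l : ℤ, D * r i = l := by
  have := Fintype.ofFinite κ
  refine ⟨∏ i, (r i).den, Finset.prod_pos fun i _ => (r i).den_pos, fun i => ?_⟩
  obtain ⟨m, hm⟩ := Finset.dvd_prod_of_mem (fun i => (r i).den) (Finset.mem_univ i)
  refine ⟨m * (r i).num, ?_⟩
  rw [hm]
  push_cast
  rw [← Rat.den_mul_eq_num]
  ring

theorem sum_mul_inner_mul_inner {ι : Type*} [Fintype ι] {P Q w : ι → ℝ} {s : ℝ} (hs : 0 < s)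
    (hPP : ∑ k, w k * P k ^ 2 = s ^ 2) (hQQ : ∑ k, w k * Q k ^ 2 = s ^ 2)
    (hPQ : ∑ k, w k * (P k * Q k) = 0) (u v : Plane) :
    ∑ k, w k * (⟪(!₂[P k / s, Q k / s] : Plane), u⟫ * ⟪(!₂[P k / s, Q k / s] : Plane), v⟫) =
      ⟪u, v⟫ :=
  calc
    _ = (∑ k, w k * P k ^ 2) * (u 0 * v 0 / s ^ 2) + (∑ k, w k * Q k ^ 2) * (u 1 * v 1 / s ^ 2) +
        (∑ k, w k * (P k * Q k)) * ((u 0 * v 1 + u 1 * v 0) / s ^ 2) := by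
      simp only [Finset.sum_mul, ← Finset.sum_add_distrib]
      refine Finset.sum_congr rfl fun k _ => ?_
      simp only [PiLp.inner_apply, Fin.sum_univ_two, RCLike.inner_apply, conj_trivial,
        Matrix.cons_val_zero, Matrix.cons_val_one]
      field_simp
      ring
    _ = ⟪u, v⟫ := by
      rw [hPP, hQQ, hPQ]
      simp only [PiLp.inner_apply, Fin.sum_univ_two, RCLike.inner_apply, conj_trivial]
      field_simp
      ring

theorem exists_isProperBiharmonicSystem_of_rat {ι : Type*} [Fintype ι] {P Q w : ι → ℚ} {σ δ : ℚ}
    (hσ : 0 < σ) (hδ : δ ≠ 0) (hw : ∀ k, 0 < w k) (hsum : ∑ k, w k = 1)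
    (hPP : ∑ k, w k * P k ^ 2 = σ) (hQQ : ∑ k, w k * Q k ^ 2 = σ)
    (hPQ : ∑ k, w k * (P k * Q k) = 0) (hP : ∀ k, 0 < P k)
    (hinj : Function.Injective fun k => (P k, Q k))
    (hdev : ∀ k, (P k ^ 2 + Q k ^ 2 - 2 * σ) ^ 2 = δ) :
    ∃ (a : ℝ) (f : ι → Plane), IsProperBiharmonicSystem a (δ / σ ^ 2) f fun k => w k := by
  obtain ⟨D, hD, hinteger⟩ := exists_common_denominator (Sum.elim P Q)
  have hσ' : (0 : ℝ) < σ := by exact_mod_cast hσ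
  have hs : 0 < √(σ : ℝ) := Real.sqrt_pos.2 hσ'
  have hsq : √(σ : ℝ) ^ 2 = σ := Real.sq_sqrt hσ'.le
  have hdual (r : ℚ) (hr : ∃ l : ℤ, D * r = l) : ∃ l : ℤ, D * √(σ : ℝ) * (r / √(σ : ℝ)) = l :=
    hr.imp fun l hl => by
      rw [mul_assoc, mul_div_cancel₀ _ hs.ne']
      exact_mod_cast hl
  let f (k : ι) : Plane := !₂[P k / √(σ : ℝ), Q k / √(σ : ℝ)]
  have hpos (k : ι) : 0 < f k 0 := div_pos (Rat.cast_pos.2 (hP k)) hs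
  have hf : Function.Injective f := fun k l h => by
    have hcoord (i : Fin 2) : f k i = f l i := by rw [h]
    refine hinj (Prod.ext ?_ ?_)
    · exact_mod_cast (div_left_inj' hs.ne').1 (hcoord 0)
    · exact_mod_cast (div_left_inj' hs.ne').1 (hcoord 1)
  refine ⟨D * √(σ : ℝ), f, ⟨by positivity, by positivity, ?_, ?_, ?_, fun k => ?_, ?_, ?_⟩⟩
  · exact_mod_cast hw
  · exact_mod_cast hsum
  · exact sum_mul_inner_mul_inner hs (by rw [hsq]; exact_mod_cast hPP)
      (by rw [hsq]; exact_mod_cast hQQ) (by exact_mod_cast hPQ)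
  · exact Fin.forall_fin_two.2 ⟨hdual _ (hinteger (.inl k)), hdual _ (hinteger (.inr k))⟩
  · refine hf.sumElim (neg_injective.comp hf) fun k l h => ?_
    have h0 : f k 0 = -f l 0 := by rw [h]; rfl
    linarith [hpos k, hpos l]
  · intro k
    have hnorm : ‖f k‖ ^ 2 = (P k ^ 2 + Q k ^ 2) / (σ : ℝ) := by
      rw [EuclideanSpace.real_norm_sq_eq, Fin.sum_univ_two, ← hsq, add_div, ← div_pow, ← div_pow]
      rfl
    rw [hnorm, div_sub' hσ'.ne', div_pow, mul_comm (σ : ℝ)]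
    congr 1
    exact_mod_cast hdev k

section Completion

variable {κ : Type*} {p q : κ → ℚ} {x y : ℚ}

/-- The points `(p k, q k)` together with two extra points `(x, ±y)`, by which their matrix of
second moments is made a multiple of the identity. -/
def completedPoint (p q : κ → ℚ) (x y : ℚ) : κ ⊕ Bool → ℚ × ℚ :=
  Sum.elim (fun k => (p k, q k)) fun b => (x, bif b then y else -y)

/-- The weights of `completedPoint`: half of the total weight is shared by the original points, and
the other half by the two extra ones. -/
def completedWeight (κ : Type*) [Fintype κ] : κ ⊕ Bool → ℚ :=
  Sum.elim (fun _ => (2 * Fintype.card κ : ℚ)⁻¹) fun _ => 1 / 4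

theorem completedPoint_injective (hcircle : ∀ k, p k ^ 2 + q k ^ 2 = 1)
    (hq : Function.Injective q) (hy : 0 < y) (hxy : 1 < x ^ 2 + y ^ 2) :
    Function.Injective (completedPoint p q x y) := by
  refine Function.Injective.sumElim (fun k l h => hq (congrArg Prod.snd h)) ?_ fun k b h => ?_
  · rintro (_ | _) (_ | _) h
    · rfl
    · have h2 : -y = y := congrArg Prod.snd h
      linarith
    · have h2 : y = -y := congrArg Prod.snd h
      linarith
    · rfl
  · have hnorm : (bif b then y else -y) ^ 2 = y ^ 2 := by cases b <;> simp
    have h1 : p k = x := congrArg Prod.fst h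
    have h2 : q k = bif b then y else -y := congrArg Prod.snd h
    have := hcircle k
    rw [h1, h2, hnorm] at this
    exact hxy.ne' this

theorem completedWeight_pos [Fintype κ] (k : κ ⊕ Bool) : 0 < completedWeight κ k := by
  rcases k with k | b
  · have : Nonempty κ := ⟨k⟩
    have : 0 < (Fintype.card κ : ℚ) := Nat.cast_pos.2 Fintype.card_pos
    exact inv_pos.2 (by positivity)
  · norm_num [completedWeight]

theorem sum_completedWeight_mul [Fintype κ] (g : κ ⊕ Bool → ℚ) :
    ∑ k, completedWeight κ k * g k =
      (∑ k, g (.inl k)) / Fintype.card κ / 2 + (g (.inr true) + g (.inr false)) / 4 := by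
  simp only [Fintype.sum_sum_type, Fintype.sum_bool, completedWeight, Sum.elim_inl, Sum.elim_inr,
    ← Finset.mul_sum, mul_inv]
  ring

theorem sum_completedWeight [Fintype κ] [Nonempty κ] : ∑ k, completedWeight κ k = 1 := by
  have h := sum_completedWeight_mul (κ := κ) 1
  have hcard : (Fintype.card κ : ℚ) ≠ 0 := Nat.cast_ne_zero.2 Fintype.card_ne_zero
  simp only [Pi.one_apply, mul_one] at h
  rw [h]
  norm_num [hcard]

end Completion

theorem exists_pos_add_sq_eq_add_sq {α β : ℚ} (hα : 0 ≤ α) (hβ : 0 ≤ β) (hadd : α + β = 1) :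
    ∃ x y : ℚ, 0 < x ∧ 0 < y ∧ α + x ^ 2 = β + y ^ 2 ∧ 1 < x ^ 2 + y ^ 2 := by
  refine ⟨1 - (α - β) / 4, 1 + (α - β) / 4, by linarith, by linarith, by ring, ?_⟩
  calc
    1 < 2 + (α - β) ^ 2 / 8 := by linarith [sq_nonneg (α - β)]
    _ = (1 - (α - β) / 4) ^ 2 + (1 + (α - β) / 4) ^ 2 := by ring

theorem exists_isProperBiharmonicSystem_of_circle {κ : Type*} [Fintype κ] [Nonempty κ]
    {p q : κ → ℚ} (hcircle : ∀ k, p k ^ 2 + q k ^ 2 = 1) (hp : ∀ k, 0 < p k)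
    (hq : Function.Injective q) (hpq : ∑ k, p k * q k = 0) :
    ∃ (a c : ℝ) (f : κ ⊕ Bool → Plane) (w : κ ⊕ Bool → ℝ), IsProperBiharmonicSystem a c f w := by
  let α : ℚ := (∑ k, p k ^ 2) / Fintype.card κ
  let β : ℚ := (∑ k, q k ^ 2) / Fintype.card κ
  have hadd : α + β = 1 := by
    simp [α, β, ← add_div, ← Finset.sum_add_distrib, hcircle]
  obtain ⟨x, y, hx, hy, hbalance, hxy⟩ := exists_pos_add_sq_eq_add_sq
    (by positivity : 0 ≤ α) (by positivity : 0 ≤ β) hadd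
  let Z := completedPoint p q x y
  have hPP : ∑ k, completedWeight κ k * (Z k).1 ^ 2 = (1 + (x ^ 2 + y ^ 2)) / 4 := by
    rw [sum_completedWeight_mul]
    change α / 2 + (x ^ 2 + x ^ 2) / 4 = _
    linarith
  have hQQ : ∑ k, completedWeight κ k * (Z k).2 ^ 2 = (1 + (x ^ 2 + y ^ 2)) / 4 := by
    rw [sum_completedWeight_mul]
    change β / 2 + (y ^ 2 + (-y) ^ 2) / 4 = _
    linarith
  have hPQ : ∑ k, completedWeight κ k * ((Z k).1 * (Z k).2) = 0 := by
    rw [sum_completedWeight_mul]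
    change (∑ k, p k * q k) / Fintype.card κ / 2 + (x * y + x * -y) / 4 = 0
    rw [hpq]
    ring
  have hdev (k) : ((Z k).1 ^ 2 + (Z k).2 ^ 2 - 2 * ((1 + (x ^ 2 + y ^ 2)) / 4)) ^ 2 =
      ((x ^ 2 + y ^ 2 - 1) / 2) ^ 2 := by
    rcases k with k | _ | _
    · change (p k ^ 2 + q k ^ 2 - _) ^ 2 = _
      rw [hcircle]
      ring
    · change (x ^ 2 + (-y) ^ 2 - _) ^ 2 = _
      ring
    · change (x ^ 2 + y ^ 2 - _) ^ 2 = _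
      ring
  obtain ⟨a, f, S⟩ := exists_isProperBiharmonicSystem_of_rat (by positivity)
    (pow_ne_zero 2 (by linarith)) completedWeight_pos sum_completedWeight hPP hQQ hPQ
    (Sum.forall.2 ⟨hp, fun _ => hx⟩) (completedPoint_injective hcircle hq hy hxy) hdev
  exact ⟨a, _, f, _, S⟩

theorem exists_injective_rev_eq_neg (M : ℕ) : ∃ t : Fin M → ℚ,
    Function.Injective t ∧ (∀ k, |t k| < 1) ∧ ∀ k, t k.rev = -t k := by
  have hval (k : Fin M) : (k : ℚ) + (k.rev : ℚ) + 1 = M := by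
    have : (k : ℕ) + k.rev + 1 = M := by have := k.isLt; rw [Fin.val_rev]; omega
    exact_mod_cast this
  have hM (k : Fin M) : (0 : ℚ) < M := by exact_mod_cast k.pos
  refine ⟨fun k => (k - (k.rev : ℚ)) / M, fun k l h => ?_, fun k => ?_, fun k => ?_⟩
  · have h' : (k : ℚ) - (k.rev : ℚ) = l - (l.rev : ℚ) := (div_left_inj' (hM k).ne').1 h
    exact Fin.ext (by exact_mod_cast (by linarith [hval k, hval l] : (k : ℚ) = l))
  · have hnonneg (l : Fin M) : (0 : ℚ) ≤ l := Nat.cast_nonneg _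
    rw [abs_lt, lt_div_iff₀ (hM k), div_lt_one (hM k)]
    constructor <;> linarith [hval k, hnonneg k, hnonneg k.rev]
  · simp only [Fin.rev_rev, ← neg_div, neg_sub]

theorem eq_of_two_mul_div_one_add_sq_eq {K : Type*} [Field K] [LinearOrder K]
    [IsStrictOrderedRing K] {s t : K} (hs : |s| < 1) (ht : |t| < 1)
    (h : 2 * s / (1 + s ^ 2) = 2 * t / (1 + t ^ 2)) : s = t := by
  rw [div_eq_div_iff (by positivity) (by positivity)] at h
  have hfactor : (s - t) * (1 - s * t) = 0 := by linear_combination h / 2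
  have hst : s * t < 1 := by
    refine (le_abs_self _).trans_lt ?_
    rw [abs_mul]
    exact mul_lt_one_of_nonneg_of_lt_one_left (abs_nonneg s) hs ht.le
  exact sub_eq_zero.1 ((mul_eq_zero.1 hfactor).resolve_right (sub_pos.2 hst).ne')

theorem exists_rational_points_circle (M : ℕ) : ∃ p q : Fin M → ℚ,
    (∀ k, p k ^ 2 + q k ^ 2 = 1) ∧ (∀ k, 0 < p k) ∧ Function.Injective q ∧
      ∑ k, p k * q k = 0 := by
  obtain ⟨t, hinj, hlt, hrev⟩ := exists_injective_rev_eq_neg M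
  have hpos (k : Fin M) : 0 < 1 + t k ^ 2 := by positivity
  refine ⟨fun k => (1 - t k ^ 2) / (1 + t k ^ 2), fun k => 2 * t k / (1 + t k ^ 2), fun k => ?_,
    fun k => ?_, fun k l h => ?_, ?_⟩
  · have := (hpos k).ne'
    field_simp
    ring
  · exact div_pos (sub_pos.2 ((sq_lt_one_iff_abs_lt_one _).2 (hlt k))) (hpos k)
  · exact hinj (eq_of_two_mul_div_one_add_sq_eq (hlt k) (hlt l) h)
  · have h := Equiv.sum_comp Fin.revPerm fun k =>
      (1 - t k ^ 2) / (1 + t k ^ 2) * (2 * t k / (1 + t k ^ 2))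
    simp only [Fin.revPerm_apply, hrev, neg_sq, mul_neg, neg_div, Finset.sum_neg_distrib] at h
    exact self_eq_neg.1 h.symm

end Frequencies

end SquareTorusImmersion

end

theorem mainTheorem3 (n : ℕ) (hodd : Odd n) (hn : 5 ≤ n) :
    ∃ a : ℝ, 0 < a ∧
      ∃ φ : SquareTorusImmersion.SquareTorus a → SquareTorusImmersion.UnitSphere n,
        SquareTorusImmersion.IsRiemannianImmersion φ ∧
        SquareTorusImmersion.IsFull φ ∧
        SquareTorusImmersion.IsCMC φ ∧
        SquareTorusImmersion.IsProperBiharmonic φ := by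
  obtain ⟨r, rfl⟩ := hodd
  have : Nonempty (Fin (r - 1)) := ⟨⟨0, by omega⟩⟩
  obtain ⟨p, q, hcircle, hp, hq, hpq⟩ :=
    SquareTorusImmersion.exists_rational_points_circle (r - 1)
  obtain ⟨a, c, f, w, S⟩ :=
    SquareTorusImmersion.exists_isProperBiharmonicSystem_of_circle hcircle hp hq hpq
  have hcard : 2 * Fintype.card (Fin (r - 1) ⊕ Bool) = 2 * r + 1 + 1 := by
    rw [Fintype.card_sum, Fintype.card_fin, Fintype.card_bool]
    omega
  exact ⟨a, S.pos, S.exists_isProperBiharmonic hcard⟩
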